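/- Let $A$ be a unital $C^*$-algebra with centre $Z(A)$, let $l_2(A)$ be the standard (right) Hilbert $A$-module of all sequences $(x_n)$ in $A$ for which $\sum_n x_n^*x_n$ converges in norm, with norm $\|x\|=\|\sum_n x_n^*x_n\|^{1/2}$, and let $B(l_2(A))$ be the set of all bounded $A$-linear (not necessarily adjointable) operators on $l_2(A)$. Write $\tilde\oplus$ for a direct sum of closed submodules, not necessarily orthogonal; "isomorphism" means a bounded $A$-linear bijection with bounded inverse; $R(\cdot)$ denotes the range. For $\alpha\in Z(A)$ let $\alpha I$ be the operator $x\mapsto x\alpha$. Let $P(l_2(A))$ be the set of idempotents in $B(l_2(A))$, not necessarily adjointable, whose kernel is a finitely generated $A$-module. For $P\in P(l_2(A))$ and $G\in B(l_2(A))$ let $\sigma^A_{d0}(PG|_{R(P)})$ be the set of all $\alpha\in Z(A)$ for which there is no decomposition $R(P)=\tilde N\,\tilde\oplus\,\tilde{\tilde N}$ such that $(PG-\alpha I)|_{\tilde N}$ is an isomorphism of $\tilde N$ onto $R(P)$. Let $\widehat{\widehat{\mathcal M\Phi}}{}_-^+(l_2(A))$ be the set of all $G\in B(l_2(A))$ for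 which there are decompositions $l_2(A)=M_1\tilde\oplus N_1$ and $l_2(A)=M_2\tilde\oplus N_2$ into closed submodules and a closed submodule $N$ such that $G(N_1)\subseteq N_2$, $G$ maps $M_1$ isomorphically onto $M_2$, $N_2$ is finitely generated, $l_2(A)=M_1\tilde\oplus N\tilde\oplus N_2$, and, for the projection $P$ onto $M_1\tilde\oplus N$ along $N_2$, there is a decomposition $R(P)=\tilde N\,\tilde\oplus\,\tilde{\tilde N}$ such that $PG|_{\tilde N}$ is an isomorphism of $\tilde N$ onto $R(P)$. Put $$\sigma^A_{e\tilde d0}(G)=\{\alpha\in Z(A) : G-\alpha I\notin \widehat{\widehat{\mathcal M\Phi}}{}_-^+(l_2(A))\}.$$ Theorem. For every $G\in B(l_2(A))$, $$\sigma^A_{e\tilde d0}(G)=\bigcap_{P\in P(l_2(A))}\sigma^A_{d0}\bigl(PG|_{R(P)}\bigr).$$ -/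

import Mathlib

open scoped MulOpposite

noncomputable section

/-! ### Positive series in a C⋆-algebra -/

/-- Comparison test for series of positive elements of a C⋆-algebra. -/
lemma summable_of_nonneg_of_le_cstar {A : Type*} [CStarAlgebra A] [PartialOrder A]
    [StarOrderedRing A] {f g : ℕ → A} (hf : ∀ n, 0 ≤ f n) (hfg : ∀ n, f n ≤ g n)
    (hg : Summable g) : Summable f := by
  rw [summable_iff_vanishing_norm] at hg ⊢
  intro ε hε
  obtain ⟨s, hs⟩ := hg ε hε
  refine ⟨s, fun t ht => lt_of_le_of_lt ?_ (hs t ht)⟩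
  exact CStarAlgebra.norm_le_norm_of_nonneg_of_le (Finset.sum_nonneg fun i _ => hf i)
    (Finset.sum_le_sum fun i _ => hfg i)

lemma star_add_mul_add_le {A : Type*} [CStarAlgebra A] [PartialOrder A]
    [StarOrderedRing A] (x y : A) {t : ℝ} (ht : 0 < t) :
    star (x + y) * (x + y) ≤ (1 + t) • (star x * x) + (1 + t⁻¹) • (star y * y) := by
  have h : 0 ≤ t⁻¹ • (star (t • x - y) * (t • x - y)) :=
    smul_nonneg (inv_nonneg.2 ht.le) (star_mul_self_nonneg _)
  have e : (1 + t) • (star x * x) + (1 + t⁻¹) • (star y * y) - star (x + y) * (x + y)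
      = t⁻¹ • (star (t • x - y) * (t • x - y)) := by
    simp only [star_add, star_sub, star_smul, star_trivial, add_mul, mul_add, sub_mul, mul_sub,
      smul_sub, smul_mul_assoc, mul_smul_comm, add_smul, one_smul, smul_smul,
      inv_mul_cancel₀ ht.ne', ← mul_assoc, one_mul]
    abel
  rw [← sub_nonneg, e]
  exact h

lemma summable_star_add_mul_add {A : Type*} [CStarAlgebra A] {x y : ℕ → A}
    (hx : Summable fun n => star (x n) * x n) (hy : Summable fun n => star (y n) * y n) :
    Summable fun n => star (x n + y n) * (x n + y n) := by
  let := CStarAlgebra.spectralOrder A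
  let := CStarAlgebra.spectralOrderedRing A
  exact summable_of_nonneg_of_le_cstar (fun n => star_mul_self_nonneg _)
    (fun n => star_add_mul_add_le (x n) (y n) one_pos)
    ((hx.const_smul (1 + 1 : ℝ)).add (hy.const_smul (1 + (1 : ℝ)⁻¹)))

/-! ### The standard Hilbert module -/

/-- The right `A`-submodule of `A^ℕ` of the sequences `x` for which `∑ xₙ⋆ xₙ` converges in norm
(the terms are positive, so convergence is the same as unconditional convergence). -/
def l2Submodule (A : Type*) [CStarAlgebra A] : Submodule Aᵐᵒᵖ (ℕ → A) where
  carrier := {x | Summable fun n => star (x n) * x n}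
  zero_mem' := by simp
  add_mem' hx hy := summable_star_add_mul_add hx hy
  smul_mem' a x hx := by
    have h := (Summable.mul_left (star a.unop) hx).mul_right a.unop
    simpa [mul_assoc] using h

/-- The standard Hilbert module `l₂(A)` over `A`, as a right `A`-module. -/
def StdModule (A : Type*) [CStarAlgebra A] : Type _ := l2Submodule A

namespace StdModule

variable {A : Type*} [CStarAlgebra A]

instance : AddCommGroup (StdModule A) := inferInstanceAs (AddCommGroup (l2Submodule A))

instance : Module Aᵐᵒᵖ (StdModule A) := inferInstanceAs (Module Aᵐᵒᵖ (l2Submodule A))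

instance : CoeFun (StdModule A) fun _ => ℕ → A := ⟨fun x => x.1⟩

lemma summable (x : StdModule A) : Summable fun n => star (x n) * x n := x.2

/-- The norm `‖x‖ = ‖∑ xₙ⋆ xₙ‖ ^ (1/2)` of the Hilbert module. -/
instance : Norm (StdModule A) := ⟨fun x => √‖∑' n, star (x n) * x n‖⟩

lemma norm_def (x : StdModule A) : ‖x‖ = √‖∑' n, star (x n) * x n‖ := rfl

lemma norm_sq (x : StdModule A) : ‖x‖ ^ 2 = ‖∑' n, star (x n) * x n‖ :=
  Real.sq_sqrt (norm_nonneg _)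

lemma norm_nonneg' (x : StdModule A) : 0 ≤ ‖x‖ := Real.sqrt_nonneg _

lemma eq_zero_of_norm (x : StdModule A) (h : ‖x‖ = 0) : x = 0 := by
  let := CStarAlgebra.spectralOrder A
  let := CStarAlgebra.spectralOrderedRing A
  have h0 : ∑' n, star (x n) * x n = 0 := by
    rw [← norm_eq_zero, ← norm_sq, h]; simp
  refine Subtype.ext (funext fun n => ?_)
  have h1 : star (x n) * x n ≤ ∑' n, star (x n) * x n :=
    x.summable.le_tsum n fun m _ => star_mul_self_nonneg _
  have h2 : star (x n) * x n = 0 := le_antisymm (h1.trans_eq h0) (star_mul_self_nonneg _)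
  exact (CStarRing.star_mul_self_eq_zero_iff _).1 h2

lemma norm_add_sq_le (x y : StdModule A) {t : ℝ} (ht : 0 < t) :
    ‖x + y‖ ^ 2 ≤ (1 + t) * ‖x‖ ^ 2 + (1 + t⁻¹) * ‖y‖ ^ 2 := by
  let := CStarAlgebra.spectralOrder A
  let := CStarAlgebra.spectralOrderedRing A
  have hx := x.summable.const_smul (1 + t)
  have hy := y.summable.const_smul (1 + t⁻¹)
  have hle : ∑' n, star ((x + y) n) * (x + y) n ≤
      (1 + t) • (∑' n, star (x n) * x n) + (1 + t⁻¹) • ∑' n, star (y n) * y n := by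
    rw [← x.summable.tsum_const_smul, ← y.summable.tsum_const_smul, ← hx.tsum_add hy]
    exact (x + y).summable.tsum_le_tsum (fun n => star_add_mul_add_le (x n) (y n) ht) (hx.add hy)
  have h0 : 0 ≤ ∑' n, star ((x + y) n) * (x + y) n :=
    tsum_nonneg fun n => star_mul_self_nonneg _
  have hti : 0 < t⁻¹ := inv_pos.2 ht
  calc ‖x + y‖ ^ 2 = ‖∑' n, star ((x + y) n) * (x + y) n‖ := norm_sq _
    _ ≤ _ := CStarAlgebra.norm_le_norm_of_nonneg_of_le h0 hle
    _ ≤ _ := norm_add_le _ _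
    _ = _ := by
      rw [norm_smul, norm_smul, norm_sq, norm_sq, Real.norm_of_nonneg (by positivity),
        Real.norm_of_nonneg (by positivity)]

lemma norm_add_le' (x y : StdModule A) : ‖x + y‖ ≤ ‖x‖ + ‖y‖ := by
  rcases (norm_nonneg' x).eq_or_lt with hx | hx
  · rw [eq_zero_of_norm x hx.symm, zero_add]
    exact le_add_of_nonneg_left (norm_nonneg' _)
  rcases (norm_nonneg' y).eq_or_lt with hy | hy
  · rw [eq_zero_of_norm y hy.symm, add_zero]
    exact le_add_of_nonneg_right (norm_nonneg' _)
  refine le_of_sq_le_sq ?_ (by positivity)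
  refine (norm_add_sq_le x y (div_pos hy hx)).trans_eq ?_
  field_simp
  ring

instance : NormedAddCommGroup (StdModule A) :=
  AddGroupNorm.toNormedAddCommGroup
    { toFun := fun x => ‖x‖
      map_zero' := by
        have h : ∀ n, (0 : StdModule A) n = 0 := fun _ => rfl
        simp [norm_def, h]
      add_le' := norm_add_le'
      neg' := fun x => by
        have h : ∀ n, (-x) n = -(x n) := fun _ => rfl
        simp [norm_def, h]
      eq_zero_of_map_eq_zero' := eq_zero_of_norm }

instance : IsBoundedSMul Aᵐᵒᵖ (StdModule A) := IsBoundedSMul.of_norm_smul_le fun a x => by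
  refine le_of_sq_le_sq ?_ (by positivity)
  have h : ∀ n, (a • x) n = x n * a.unop := fun _ => rfl
  have e : ∑' n, star ((a • x) n) * (a • x) n
      = star a.unop * (∑' n, star (x n) * x n) * a.unop := by
    rw [← x.summable.tsum_mul_left, ← (x.summable.mul_left _).tsum_mul_right]
    simp [h, mul_assoc]
  rw [norm_sq, e, mul_pow, norm_sq]
  refine (norm_mul_le _ _).trans ((mul_le_mul_of_nonneg_right (norm_mul_le _ _)
    (norm_nonneg _)).trans_eq ?_)
  rw [norm_star, MulOpposite.norm_unop]
  ring

end StdModule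

/-! ### Operators on a normed right `A`-module -/

section Operators

variable {A : Type*} [CStarAlgebra A]
  {E : Type*} [NormedAddCommGroup E] [Module Aᵐᵒᵖ E] [ContinuousConstSMul Aᵐᵒᵖ E]

/-- The operator `α I`, `x ↦ x α`, for `α` in the centre `Z(A)`. -/
def centralScalar (E : Type*) [NormedAddCommGroup E] [Module Aᵐᵒᵖ E]
    [ContinuousConstSMul Aᵐᵒᵖ E] (α : Subalgebra.center ℂ A) : E →L[Aᵐᵒᵖ] E where
  toFun x := MulOpposite.op (α : A) • x
  map_add' := smul_add _
  map_smul' a x := by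
    have h : (α : A) * a.unop = a.unop * α := (Subalgebra.mem_center_iff.1 α.2 a.unop).symm
    simp only [smul_smul, RingHom.id_apply]
    congr 1
    exact MulOpposite.unop_injective (by simpa using h.symm)
  cont := continuous_const_smul _

/-- `E` splits as a direct sum (not necessarily orthogonal) of closed submodules, one of which is
mapped isomorphically onto all of `E` by `T`. -/
def SplitsOnto (T : E →L[Aᵐᵒᵖ] E) : Prop :=
  ∃ N N' : Submodule Aᵐᵒᵖ E, IsClosed (N : Set E) ∧ IsClosed (N' : Set E) ∧ IsCompl N N' ∧
    (T.comp N.subtypeL).IsInvertible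

/-- The defect spectrum `σ_{d0}` of an operator `T` on `E`. -/
def defectSpectrum (T : E →L[Aᵐᵒᵖ] E) : Set (Subalgebra.center ℂ A) :=
  {α | ¬ SplitsOnto (T - centralScalar E α)}

/-- For operators `P, G` on `E`, the operator `P G` restricted to the range `R(P)`,
as an operator on `R(P)`. -/
def compression (P G : E →L[Aᵐᵒᵖ] E) :
    LinearMap.range (P : E →ₗ[Aᵐᵒᵖ] E) →L[Aᵐᵒᵖ] LinearMap.range (P : E →ₗ[Aᵐᵒᵖ] E) :=
  ((P.comp G).comp (LinearMap.range (P : E →ₗ[Aᵐᵒᵖ] E)).subtypeL).codRestrict _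
    fun x => ⟨G x, rfl⟩

/-- The bounded `A`-linear projections (idempotents, not necessarily adjointable) on `E` with
finitely generated kernel. -/
def fgKerProjections (A E : Type*) [CStarAlgebra A] [NormedAddCommGroup E] [Module Aᵐᵒᵖ E] :
    Set (E →L[Aᵐᵒᵖ] E) :=
  {P | P.comp P = P ∧ (LinearMap.ker (P : E →ₗ[Aᵐᵒᵖ] E)).FG}

/-- `G` is diagonal with respect to the direct sum decompositions `E = M₁ ⊕ N₁` and `E = M₂ ⊕ N₂`
into closed submodules, and its corner `M₁ → M₂` is an isomorphism. -/
structure IsNoetherDecomposition (G : E →L[Aᵐᵒᵖ] E) (M₁ N₁ M₂ N₂ : Submodule Aᵐᵒᵖ E) : Prop where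
  closed_M₁ : IsClosed (M₁ : Set E)
  closed_N₁ : IsClosed (N₁ : Set E)
  closed_M₂ : IsClosed (M₂ : Set E)
  closed_N₂ : IsClosed (N₂ : Set E)
  isCompl_dom : IsCompl M₁ N₁
  isCompl_cod : IsCompl M₂ N₂
  maps_N : ∀ x ∈ N₁, G x ∈ N₂
  iso_M : ∃ e : M₁ ≃L[Aᵐᵒᵖ] M₂, ∀ x : M₁, (e x : E) = G x

/-- The class of operators `G` having a decomposition `E = M₁ ⊕ N₁ → M₂ ⊕ N₂ = E` as above with
`N₂` finitely generated and `E = M₁ ⊕ N ⊕ N₂` for some closed submodule `N`, such that for the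
projection `P` onto `M₁ ⊕ N` along `N₂` the range `R(P)` splits into two closed submodules, one of
which is mapped isomorphically onto `R(P)` by `P G`. -/
def IsHatSemiFredholmMinusPlus (G : E →L[Aᵐᵒᵖ] E) : Prop :=
  ∃ M₁ N₁ M₂ N₂ N : Submodule Aᵐᵒᵖ E, IsNoetherDecomposition G M₁ N₁ M₂ N₂ ∧ N₂.FG ∧
    IsClosed (N : Set E) ∧ Disjoint M₁ N ∧ IsCompl (M₁ ⊔ N) N₂ ∧
    ∃ P : E →L[Aᵐᵒᵖ] E, P.comp P = P ∧ LinearMap.range (P : E →ₗ[Aᵐᵒᵖ] E) = M₁ ⊔ N ∧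
      LinearMap.ker (P : E →ₗ[Aᵐᵒᵖ] E) = N₂ ∧ SplitsOnto (compression P G)

/-- The essential defect spectrum `σ_{ed̃0}` of an operator `G` on `E`. -/
def essDefectSpectrum (G : E →L[Aᵐᵒᵖ] E) : Set (Subalgebra.center ℂ A) :=
  {α | ¬ IsHatSemiFredholmMinusPlus (G - centralScalar E α)}

end Operators

end

section Operators

variable {A : Type*} [CStarAlgebra A]
  {E : Type*} [NormedAddCommGroup E] [Module Aᵐᵒᵖ E]

/-! Put `F = G - αI`. Since `α I` commutes with an idempotent `P`, `α` lies outside the defect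
spectrum of the compression of `G` exactly when the compression of `F` splits onto `R(P)`. So the
theorem says that `F` is in the class iff some such `P` has finitely generated kernel. One direction
is immediate, as the class supplies `P`. Conversely, let `R(P) = K ⊕ K'` with `PF|K` an isomorphism
onto `R(P)`, and put `S = (PF|K)⁻¹P`. Then `SF = id` on `K`, so `SF` and `FS` are bounded
idempotents on `E`: `SF` projects onto `K` along `ker PF`, and `FS` onto `F(K)` along `ker P`. They
give the decomposition, with `N = K'`. -/

lemma compression_sub_centralScalar [ContinuousConstSMul Aᵐᵒᵖ E] {P : E →L[Aᵐᵒᵖ] E}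
    [ContinuousConstSMul Aᵐᵒᵖ (LinearMap.range (P : E →ₗ[Aᵐᵒᵖ] E))] (hP : P.comp P = P)
    (G : E →L[Aᵐᵒᵖ] E) (α : Subalgebra.center ℂ A) :
    compression P (G - centralScalar E α) = compression P G - centralScalar _ α := by
  ext ⟨_, x, rfl⟩
  -- `P` is the identity on its range, so compressing `α I` gives `α I` again.
  have h : P (P x) = P x := DFunLike.congr_fun hP x
  change P (G (P x) - MulOpposite.op (α : A) • P x) = P (G (P x)) - MulOpposite.op (α : A) • P x
  rw [map_sub, map_smul, h]

/-- A projection with finitely generated kernel whose compression of `F` splits onto its range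
yields a Noether decomposition of `F` with the same kernel as second defect module. -/
lemma isHatSemiFredholmMinusPlus_of_splitsOnto {P F : E →L[Aᵐᵒᵖ] E} (hP : P.comp P = P)
    (hker : (LinearMap.ker (P : E →ₗ[Aᵐᵒᵖ] E)).FG) (hF : SplitsOnto (compression P F)) :
    IsHatSemiFredholmMinusPlus F := by
  let R := LinearMap.range (P : E →ₗ[Aᵐᵒᵖ] E)
  obtain ⟨(K : Submodule Aᵐᵒᵖ R), (K' : Submodule Aᵐᵒᵖ R), hK, hK', hKK', (e : K ≃L[Aᵐᵒᵖ] R), he⟩ :=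
    id hF
  have hPP (x : E) : P (P x) = P x := DFunLike.congr_fun hP x
  have hPR (x : E) (hx : x ∈ R) : P x = x := by
    obtain ⟨y, rfl⟩ := hx
    exact hPP y
  have hRclosed : IsClosed (R : Set E) := by
    have : (R : Set E) = {x | P x = x} := Set.ext fun x => ⟨hPR x, fun h => ⟨x, h⟩⟩
    rw [this]
    exact isClosed_eq P.continuous continuous_id
  have hRker : IsCompl R (LinearMap.ker (P : E →ₗ[Aᵐᵒᵖ] E)) := by
    refine ⟨Submodule.disjoint_def.2 fun x hx hx' => (hPR x hx).symm.trans hx',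
      codisjoint_iff_le_sup.2 fun x _ => ?_⟩
    exact Submodule.mem_sup.2 ⟨P x, ⟨x, rfl⟩, x - P x, by simp [hPP], by abel⟩
  have hmapClosed (L : Submodule Aᵐᵒᵖ R) (hL : IsClosed (L : Set R)) :
      IsClosed (L.map R.subtype : Set E) := by
    rw [Submodule.map_coe]
    exact hRclosed.isClosedEmbedding_subtypeVal.isClosedMap _ hL
  have heF (x : K) : ((e x : R) : E) = P (F (x : R)) :=
    congrArg Subtype.val (DFunLike.congr_fun he x)
  -- `S` is a right inverse of `P ∘ F` on the range of `P`, with values in `K`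
  let Q : E →L[Aᵐᵒᵖ] R := P.codRestrict R fun x => ⟨x, rfl⟩
  let S : E →L[Aᵐᵒᵖ] K := (e.symm : R →L[Aᵐᵒᵖ] K).comp Q
  have hPFS (y : E) : P (F (S y : R)) = P y := by
    rw [← heF]
    exact congrArg Subtype.val (e.apply_symm_apply (Q y))
  have hSF (x : K) : S (F (x : R)) = x := by
    refine e.injective ((e.apply_symm_apply _).trans (Subtype.ext ?_))
    exact (heF x).symm
  have hSker (y : E) (hy : P y = 0) : S y = 0 := by
    have : Q y = 0 := Subtype.ext hy
    change e.symm (Q y) = 0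
    rw [this, map_zero]
  -- `M₁` and `N₁` are range and kernel of `SF`; `M₂` and `ker P` those of `FS`.
  let M₁ : Submodule Aᵐᵒᵖ E := K.map R.subtype
  let N₁ := LinearMap.ker (P.comp F : E →ₗ[Aᵐᵒᵖ] E)
  let M₂ := M₁.map (F : E →ₗ[Aᵐᵒᵖ] E)
  have hM₁ (x : E) (hx : x ∈ M₁) : ∃ k : K, ((k : R) : E) = x := by
    obtain ⟨k, hk, rfl⟩ := hx
    exact ⟨⟨k, hk⟩, rfl⟩
  have hM₁' (k : K) : ((k : R) : E) ∈ M₁ := ⟨k, k.2, rfl⟩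
  have hM₂ (y : E) (hy : y ∈ M₂) : F (S y : R) = y := by
    obtain ⟨x, hx, rfl⟩ := hy
    obtain ⟨k, rfl⟩ := hM₁ x hx
    exact congrArg (fun z : K => F (z : R)) (hSF k)
  have hM₂' (y : E) : F (S y : R) ∈ M₂ := ⟨_, hM₁' _, rfl⟩
  have hsup : M₁ ⊔ K'.map R.subtype = R := by
    rw [← Submodule.map_sup, hKK'.sup_eq_top, Submodule.map_top, Submodule.range_subtype]
  refine ⟨M₁, N₁, M₂, LinearMap.ker (P : E →ₗ[Aᵐᵒᵖ] E), K'.map R.subtype, ?_, hker,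
    hmapClosed K' hK', ?_, ?_, P, hP, hsup.symm, rfl, hF⟩
  · refine ⟨hmapClosed K hK, (P.comp F).isClosed_ker, ?_, P.isClosed_ker, ?_, ?_, fun x hx => hx, ?_⟩
    -- An image under `F` need not be closed, but `M₂` is the fixed-point set of the continuous map
    -- `FS`.
    · have : (M₂ : Set E) = {y | F (S y : R) = y} :=
        Set.ext fun y => ⟨hM₂ y, fun h => by
          rw [← (show F (S y : R) = y from h)]
          exact hM₂' y⟩
      rw [this]
      exact isClosed_eq (by fun_prop) continuous_id
    · refine ⟨Submodule.disjoint_def.2 fun x hx hx' => ?_,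
        codisjoint_iff_le_sup.2 fun x _ => Submodule.mem_sup.2
          ⟨_, hM₁' (S (F x)), x - (S (F x) : R), ?_, by abel⟩⟩
      · obtain ⟨k, rfl⟩ := hM₁ x hx
        have hk : k = 0 := (hSF k).symm.trans (hSker _ hx')
        simp [hk]
      · change P (F (x - (S (F x) : R))) = 0
        rw [map_sub, map_sub, hPFS, sub_self]
    · refine ⟨Submodule.disjoint_def.2 fun y hy hy' => ?_,
        codisjoint_iff_le_sup.2 fun y _ => Submodule.mem_sup.2
          ⟨_, hM₂' y, y - F (S y : R), ?_, by abel⟩⟩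
      · rw [← hM₂ y hy, hSker y hy']
        simp
      · change P (y - F (S y : R)) = 0
        rw [map_sub, hPFS, sub_self]
    -- The inverse of `F : M₁ → M₂` is the restriction of `S`, hence bounded without the open
    -- mapping theorem.
    · refine ⟨ContinuousLinearEquiv.equivOfInverse
        ((F.comp M₁.subtypeL).codRestrict M₂ fun x => ⟨x, x.2, rfl⟩)
        (((R.subtypeL.comp K.subtypeL).comp (S.comp M₂.subtypeL)).codRestrict M₁ fun y => hM₁' _)
        (fun x => ?_) (fun y => Subtype.ext (hM₂ y y.2)), fun x => rfl⟩
      obtain ⟨x, hx⟩ := x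
      obtain ⟨k, rfl⟩ := hM₁ x hx
      exact Subtype.ext (congrArg (fun z : K => ((z : R) : E)) (hSF k))
  · exact Submodule.disjoint_map R.injective_subtype hKK'.disjoint
  · rwa [hsup]

end Operators

theorem theoremT02 {A : Type*} [CStarAlgebra A] (G : StdModule A →L[Aᵐᵒᵖ] StdModule A) :
    essDefectSpectrum G =
      ⋂ P ∈ fgKerProjections A (StdModule A), defectSpectrum (compression P G) := by
  ext α
  simp only [Set.mem_iInter]
  constructor
  · rintro hα P ⟨hP, hker⟩ hs
    rw [← compression_sub_centralScalar hP] at hs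
    exact hα (isHatSemiFredholmMinusPlus_of_splitsOnto hP hker hs)
  -- Only `P` and its kernel `N₂` matter here; the Noether decomposition itself is discarded.
  · rintro hα ⟨M₁, N₁, M₂, N₂, N, -, hN₂, -, -, -, P, hP, -, hker, hs⟩
    rw [compression_sub_centralScalar hP] at hs
    exact hα P ⟨hP, hker ▸ hN₂⟩ hs
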